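/- **Setting.** Fix $k\ge 2$ and $\Sigma_k=\{0,1,\dots,k-1\}$. A *group extension $k$-automaton* $\mathcal T=(S,s_0,\Sigma_k,\delta,G,\lambda)$ consists of a finite set $S$ of states with an initial state $s_0\in S$, a transition function $\delta\colon S\times\Sigma_k\to S$, a finite group $G$ and a labelling $\lambda\colon S\times\Sigma_k\to G$. These extend to words by $\delta(s,\epsilon)=s$, $\lambda(s,\epsilon)=1$, $\delta(s,uv)=\delta(\delta(s,u),v)$ and $\lambda(s,uv)=\lambda(s,u)\lambda(\delta(s,u),v)$. For a word $w$ let $[w]_k$ be the integer with base-$k$ expansion $w$ (most significant digit first), and for $n\in\mathbb N_0$ let $(n)_k^l\in\Sigma_k^l$ be the base-$k$ expansion of $n$ truncated to its last $l$ digits or padded with leading zeros to length $l$. For $A\subset\mathbb N_0$ let $\gcd_k^*(A)$ be the greatest among the common divisors of $A$ that are coprime to $k$. $\mathcal T$ is *efficient*, with data $d'=d'_{\mathcal T}\in\mathbb N$, $G_0\le G$ and $g_0\in G$, if: * for all $s,s'\in S$ some word $w$ has $\delta(s,w)=s'$; $\delta(s_0,0)=s_0$; $\delta(s,00)=\delta(s,0)$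 and $\lambda(s,0)=\lambda(s,00)=1$ for all $s\in S$; there is a word $w$ with $\delta(s,w)=s_0$ and $\lambda(s,w)=1$ for all $s\in S$; * for all $s,s'\in S$ and all sufficiently large $l$, $\{\lambda(s,w): w\in\Sigma_k^l,\ \delta(s,w)=s'\}=G$; * for all $s,s'\in S$ and $0\le r<d'$, $\{\lambda(s,w): w\in\Sigma_k^*,\ \delta(s,w)=s',\ [w]_k\equiv r \bmod d'\}=G_0g_0^r=g_0^rG_0$; * for all $s,s'\in S$, $g\in G_0$ and all sufficiently large $l$, $\gcd_k^*\{[w]_k: w\in\Sigma_k^l,\ \delta(s,w)=s',\ \lambda(s,w)=g\}=d'$. Let $d\ge 0$. Write $X^{[d]}$ for the set of families $(x_\omega)_{\omega\in\{0,1\}^d}$ in $X$, and $1\omega\cdot e=e_0+\sum_{j=1}^d\omega_je_j$. Let $R=\{(\lfloor 1\omega\cdot t\rfloor)_\omega : t\in[0,1)^{d+1}\}$. The objects of the category $\mathcal V^d(\mathcal T)$ are the pairs $v=(s,r)\in S^{[d]}\times R$. A morphism $v=(s,r)\to v'=(s',r')$ of degree $l\ge 0$ is a vector $e\in\{0,\dots,k^l-1\}^{d+1}$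 such that for all $\omega$ $$s'_\omega=\delta\bigl(s_\omega,(1\omega\cdot e+r'_\omega)_k^l\bigr),\qquad r_\omega=\Bigl\lfloor \frac{1\omega\cdot e+r'_\omega}{k^l}\Bigr\rfloor .$$ The set of these morphisms is $\mathrm{Mor}_l(v,v')$. Put $\boldsymbol\lambda(l,e)=\bigl(\lambda(s_\omega,(1\omega\cdot e+r'_\omega)_k^l)\bigr)_\omega\in G^{[d]}$ and $\mathcal Q^d_l(\mathcal T)(v,v')=\{\boldsymbol\lambda(l,e): e\in\mathrm{Mor}_l(v,v')\}$. Let $\mathcal Q^d(\mathcal T)(v,v')$ denote the limit of $\mathcal Q^d_l(\mathcal T)(v,v')$ as $l\to\infty$, that is, the eventual value of this sequence of sets, when it exists (formally, the set of cubes lying in $\mathcal Q^d_l(\mathcal T)(v,v')$ for all sufficiently large $l$). Let $v_0=((s_0)_\omega,(0)_\omega)$ and $\mathcal Q^d(\mathcal T)=\mathcal Q^d(\mathcal T)(v_0,v_0)$. The full subcategory $\mathcal U^d(\mathcal T)$ consists of the objects $v$ that admit a morphism (of some degree) to $v_0$ and a morphism from $v_0$. A *factor map* from $\mathcal T$ to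 $\bar{\mathcal T}=(\bar S,\bar s_0,\Sigma_k,\bar\delta,\bar G,\bar\lambda)$ is a pair of a surjective map $\phi\colon S\to\bar S$ and a surjective group homomorphism $\pi\colon G\to\bar G$ with $\phi(s_0)=\bar s_0$, $\bar\delta(\phi(s),j)=\phi(\delta(s,j))$ and $\bar\lambda(\phi(s),j)=\pi(\lambda(s,j))$ for all $s\in S$, $j\in\Sigma_k$. It makes $\bar{\mathcal T}$ a *characteristic factor* of $\mathcal T$ if for every $d\ge 0$, $\mathcal Q^d(\mathcal T)$ is the full preimage of $\mathcal Q^d(\bar{\mathcal T})$ under the map $G^{[d]}\to\bar G^{[d]}$ induced by $\pi$. For $m\ge 1$, $\mathcal Z(m)$ is the group extension $k$-automaton with a single state, group $\mathbb Z/m\mathbb Z$ and labels $\lambda(j)=j\bmod m$ for $j\in\Sigma_k$. **Theorem.** Let $\mathcal T$ be an efficient group extension $k$-automaton with data $d'$, $G_0$, $g_0$. 1. For every $d\ge 0$ there exist cubes $g_v\in G^{[d]}$, for the objects $v$ of $\mathcal U^d(\mathcal T)$, and a threshold $l_0\ge 0$ such that for all $l\ge l_0$ and all objects $v,v'$ of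 $\mathcal U^d(\mathcal T)$, $$\mathcal Q^d_l(\mathcal T)(v,v')=\mathcal Q^d(\mathcal T)(v,v')=g_v^{-1}\,G_0^{[d]}\,H\,g_{v'},$$ where $H\le G^{[d]}$ is the subgroup $H=\{(g_0^{1\omega\cdot e})_{\omega\in\{0,1\}^d}: e\in\mathbb N_0^{d+1}\}$. 2. $\mathcal Z(d')$ is a characteristic factor of $\mathcal T$. -/

import Mathlib

open scoped Pointwise

/-- A group extension `k`-automaton without output, with set of states `S`, initial
state `init`, transition function `step`, group of labels `G` and labelling `lab`.  The input
alphabet is `Fin k`; finiteness of `S` and `G` and `k ≥ 2` are imposed where the structure is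
used. -/
structure GEA (k : ℕ) (S : Type*) (G : Type*) where
  init : S
  step : S → Fin k → S
  lab : S → Fin k → G

namespace GEA

/-- The integer `[w]_k` with base-`k` expansion `w`, most significant digit first. -/
def val {k : ℕ} (w : List (Fin k)) : ℕ :=
  Nat.ofDigits k (w.reverse.map (fun j => (j : ℕ)))

/-- `(n)_k^l`: the base-`k` expansion of `n`, most significant digit first, truncated to its last
`l` digits or padded with leading zeros to length `l`. -/
def expand (k : ℕ) [NeZero k] : ℕ → ℕ → List (Fin k)
  | 0, _ => []
  | l + 1, n => expand k l (n / k) ++ [Fin.ofNat k n]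

/-- `d` is the greatest among the common divisors of `A` that are coprime to `k`. -/
def IsGcdCoprime (k : ℕ) (A : Set ℕ) (d : ℕ) : Prop :=
  IsGreatest {m : ℕ | m.Coprime k ∧ ∀ a ∈ A, m ∣ a} d

section Words

variable {k : ℕ} {S G : Type*} [Group G]

/-- The extension of the transition function to words, read from left to right. -/
def stepWord (T : GEA k S G) (s : S) (w : List (Fin k)) : S :=
  w.foldl T.step s

/-- The extension of the labelling to words, read from left to right. -/
def labWord (T : GEA k S G) : S → List (Fin k) → G
  | _, [] => 1
  | s, j :: w => T.lab s j * T.labWord (T.step s j) w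

end Words

section Efficient

variable {k : ℕ} [NeZero k] {S G : Type*} [Group G]

/-- The underlying automaton is strongly connected. -/
def StronglyConnected (T : GEA k S G) : Prop :=
  ∀ s s' : S, ∃ w : List (Fin k), T.stepWord s w = s'

/-- `T` ignores leading zeros. -/
def Prolongable (T : GEA k S G) : Prop :=
  T.step T.init 0 = T.init ∧ T.lab T.init 0 = 1

def Idempotent (T : GEA k S G) : Prop :=
  T.Prolongable ∧ ∀ s : S,
    T.stepWord s [0] = T.stepWord s [0, 0] ∧ T.labWord s [0, 0] = T.labWord s [0]

/-- Some word synchronises `T` to its initial state. -/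
def Synchronising (T : GEA k S G) : Prop :=
  ∃ w : List (Fin k), ∀ s : S, T.stepWord s w = T.init ∧ T.labWord s w = 1

/-- `T` is efficient, with associated integer `d'`, subgroup `G₀` and group element `g₀`. -/
structure IsEfficientWith (T : GEA k S G) (d' : ℕ) (G₀ : Subgroup G) (g₀ : G) : Prop where
  stronglyConnected : T.StronglyConnected
  idempotent : T.Idempotent
  synchronising : T.Synchronising
  lab_zero : ∀ s : S, T.lab s 0 = 1
  labels_full : ∀ s s' : S, ∃ l₀ : ℕ, ∀ l ≥ l₀,
    {g : G | ∃ w : List (Fin k), w.length = l ∧ T.stepWord s w = s' ∧ T.labWord s w = g} =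
      Set.univ
  labels_residue : ∀ (s s' : S) (r : ℕ), r < d' →
    {g : G | ∃ w : List (Fin k), T.stepWord s w = s' ∧ val w ≡ r [MOD d'] ∧
      T.labWord s w = g} = (G₀ : Set G) * {g₀ ^ r} ∧
    (G₀ : Set G) * {g₀ ^ r} = {g₀ ^ r} * (G₀ : Set G)
  gcd_values : ∀ (s s' : S), ∀ g ∈ G₀, ∃ l₀ : ℕ, ∀ l ≥ l₀,
    IsGcdCoprime k {n : ℕ | ∃ w : List (Fin k), w.length = l ∧ T.stepWord s w = s' ∧
      T.labWord s w = g ∧ val w = n} d'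

end Efficient

/-- The vertices `ω ∈ {0,1}^d` of the cube; `X^[d]` is `Vertex d → X`. -/
abbrev Vertex (d : ℕ) : Type := Fin d → Fin 2

/-- `1ω · e = e₀ + ω₁ e₁ + ⋯ + ω_d e_d`. -/
def dot {d : ℕ} {M : Type*} [AddCommMonoid M] (ω : Vertex d) (e : Fin (d + 1) → M) : M :=
  e 0 + ∑ j : Fin d, (ω j : ℕ) • e j.succ

/-- The finite set `R` of all `(⌊1ω · t⌋)_ω` with `t ∈ [0,1)^(d+1)`. -/
def carries (d : ℕ) : Set (Vertex d → ℕ) :=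
  {r | ∃ t : Fin (d + 1) → ℝ, (∀ i, t i ∈ Set.Ico (0 : ℝ) 1) ∧ ∀ ω, r ω = ⌊dot ω t⌋₊}

theorem zero_mem_carries (d : ℕ) : (fun _ => 0) ∈ carries d :=
  ⟨fun _ => 0, fun _ => by simp, fun _ => by simp [dot]⟩

/-- The objects `v = (s, r) ∈ S^[d] × R` of the category `V^d(T)`. -/
structure Obj (d : ℕ) (S : Type*) where
  s : Vertex d → S
  r : Vertex d → ℕ
  r_mem : r ∈ carries d

section Cubes

variable {k : ℕ} [NeZero k] {S G : Type*} [Group G] {d : ℕ}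

/-- The morphisms `(l, e) : v ⟶ v'` of degree `l` in `V^d(T)`, each given by its vector
`e ∈ {0, …, k^l - 1}^(d+1)`. -/
def Mor (T : GEA k S G) (l : ℕ) (v v' : Obj d S) : Set (Fin (d + 1) → ℕ) :=
  {e | (∀ i, e i < k ^ l) ∧ ∀ ω : Vertex d,
    v'.s ω = T.stepWord (v.s ω) (expand k l (dot ω e + v'.r ω)) ∧
    v.r ω = (dot ω e + v'.r ω) / k ^ l}

/-- The value of the fundamental functor `V^d(T) ⟶ G^[d]` on `(l, e) : v ⟶ v'`. -/
def morLabel (T : GEA k S G) (l : ℕ) (v v' : Obj d S) (e : Fin (d + 1) → ℕ) : Vertex d → G :=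
  fun ω => T.labWord (v.s ω) (expand k l (dot ω e + v'.r ω))

/-- The cube family `Q^d_l(T)(v, v') ⊆ G^[d]`. -/
def cubes (T : GEA k S G) (l : ℕ) (v v' : Obj d S) : Set (Vertex d → G) :=
  T.morLabel l v v' '' T.Mor l v v'

/-- The set `Q^d(T)(v, v')`: the limit of `Q^d_l(T)(v, v')` as `l → ∞`, whenever it exists. -/
def limitCubes (T : GEA k S G) (v v' : Obj d S) : Set (Vertex d → G) :=
  {g | ∀ᶠ l in Filter.atTop, g ∈ T.cubes l v v'}

/-- The base object `v₀ = (s₀^[d], 0)`. -/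
def base (T : GEA k S G) (d : ℕ) : Obj d S :=
  ⟨fun _ => T.init, fun _ => 0, zero_mem_carries d⟩

/-- `v` is an object of the full subcategory `U^d(T)`. -/
def InU (T : GEA k S G) (v : Obj d S) : Prop :=
  (∃ l, (T.Mor l v (T.base d)).Nonempty) ∧ ∃ l, (T.Mor l (T.base d) v).Nonempty

end Cubes

/-- The subgroup `H = {(g₀^(1ω · e))_ω : e ∈ ℕ^(d+1)}` of `G^[d]`, for a finite group `G`. -/
def cubePowers {G : Type*} [Group G] [Finite G] (d : ℕ) (g₀ : G) : Subgroup (Vertex d → G) where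
  carrier := {g | ∃ e : Fin (d + 1) → ℕ, g = fun ω => g₀ ^ dot ω e}
  one_mem' := ⟨0, by funext ω; simp [dot]⟩
  mul_mem' := by
    rintro _ _ ⟨e, rfl⟩ ⟨f, rfl⟩
    refine ⟨e + f, ?_⟩
    funext ω
    simp only [Pi.mul_apply, ← pow_add]
    congr 1
    simp only [dot, Pi.add_apply, smul_add, Finset.sum_add_distrib]
    ring
  inv_mem' := by
    rintro _ ⟨e, rfl⟩
    refine ⟨fun i => (orderOf g₀ - 1) * e i, ?_⟩
    funext ω
    have h : dot ω (fun i => (orderOf g₀ - 1) * e i) = (orderOf g₀ - 1) * dot ω e := by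
      simp only [dot, mul_add, Finset.mul_sum, smul_eq_mul]
      congr 1
      exact Finset.sum_congr rfl fun j _ => by ring
    rw [Pi.inv_apply, h, inv_eq_iff_mul_eq_one, ← pow_add]
    have h1 : dot ω e + (orderOf g₀ - 1) * dot ω e = orderOf g₀ * dot ω e := by
      have := orderOf_pos g₀
      obtain ⟨m, hm⟩ : ∃ m, orderOf g₀ = m + 1 := ⟨orderOf g₀ - 1, by omega⟩
      rw [hm, Nat.add_sub_cancel]
      ring
    rw [h1, pow_mul, pow_orderOf_eq_one, one_pow]

section Factors

variable {k : ℕ} {S S' G G' : Type*} [Group G] [Group G']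

/-- A factor map `(φ, π)` from `T` to `T'`, exhibiting `T'` as a factor of `T`. -/
structure FactorMap (T : GEA k S G) (T' : GEA k S' G') where
  φ : S → S'
  π : G →* G'
  map_init : φ T.init = T'.init
  map_step : ∀ s j, T'.step (φ s) j = φ (T.step s j)
  map_lab : ∀ s j, T'.lab (φ s) j = π (T.lab s j)
  φ_surjective : Function.Surjective φ
  π_surjective : Function.Surjective π

/-- The factor is characteristic: `Q^d(T)` is the full preimage of `Q^d(T')` for every `d ≥ 0`. -/
def FactorMap.IsCharacteristic [NeZero k] {T : GEA k S G} {T' : GEA k S' G'}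
    (F : FactorMap T T') : Prop :=
  ∀ d : ℕ, T.limitCubes (T.base d) (T.base d) =
    (fun (g : Vertex d → G) ω => F.π (g ω)) ⁻¹' T'.limitCubes (T'.base d) (T'.base d)

end Factors

/-- The cyclic automaton `Z(m)`: one state, group `ℤ/mℤ`, and label `j mod m` on the digit `j`. -/
def cyclic (k m : ℕ) : GEA k Unit (Multiplicative (ZMod m)) where
  init := ()
  step := fun _ _ => ()
  lab := fun _ j => Multiplicative.ofAdd ((j : ℕ) : ZMod m)

end GEA

/-!
Let `a(n)` be the label of the base-`k` expansion of `n`, read from the initial state.  Inserting a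
synchronising word of value `Z` and length `i` between two expansions decouples them,
`a((n k^i + Z) k^l + m) = a(n) a(m)` for `m < k^l`, so the cubes `(a(1ω · e))_ω` form a subgroup `Q`
of `G^[d]`.  Appending a synchronising word to `e` shows that every element of `Q` is a cube
`v₀ ⟶ v₀` in all large degrees, and composing with fixed morphisms `v ⟶ v₀` and `v₀ ⟶ v'` reduces
the description of all cubes to that of `Q`.

The hypotheses on labels and values say that `G₀` is the kernel of a homomorphism `π` onto `ℤ/d'ℤ`
which sends the label of a word to its value (`exists_residueHom`); comparing the word `1` with the
word `1` followed by `0` gives `k ≡ 1 mod d'`.  Hence the residues of a cube `v ⟶ v'` are those of a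
linear form corrected by carries (`cubes_subset_residueCubes`).  It remains to see that these
necessary conditions suffice, which amounts to `G₀^[d] ≤ Q` (`pi_le_cubeGroup`).

Let `K` be the normal subgroup of those `g` for which the cube with `g` at the vertex `(1, …, 1)`
and `1` elsewhere lies in `Q`.  Since `Q` is invariant under the reflections of the cube, any vertex
could be used here, and `K^[d] ≤ Q`.  So modulo `K` the last entry of a cube is a function of the
others.  For the cubes over `n, n + 1, …, n + d` this is a recurrence of order `d` for `a mod K`;
thus `a mod K` is eventually periodic.  As moreover `a(k n) = a(n)`, replacing powers of `k` by an
idempotent power modulo the period turns the decoupling identity into `a(n + m) = a(n) a(m)` modulo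
`K` (`map_add_of_eventually_periodic`, `mk_seq_add`).  The order `m` of `a(1)` modulo `K` divides
`k - 1`, so it is coprime to `k`, and it divides the value of every word from the initial state with
trivial label.  The condition on greatest common divisors gives `m ∣ d'`, which means `G₀ ≤ K`
(`le_cornerGroup`).
-/

namespace GEA

/-! ### Base-`k` expansions -/

section Expansions

variable {k : ℕ} [NeZero k]

theorem length_expand (l n : ℕ) : (expand k l n).length = l := by
  induction l generalizing n with
  | zero => rfl
  | succ l ih => simp [expand, ih]

omit [NeZero k] in
theorem val_append_singleton (w : List (Fin k)) (j : Fin k) :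
    val (w ++ [j]) = val w * k + j := by
  simp [val, Nat.ofDigits_cons]
  ring

omit [NeZero k] in
theorem val_append (u w : List (Fin k)) : val (u ++ w) = val u * k ^ w.length + val w := by
  induction w using List.reverseRecOn with
  | nil => simp [val]
  | append_singleton w j ih =>
    rw [← List.append_assoc, val_append_singleton, val_append_singleton, ih, List.length_append,
      List.length_singleton, pow_succ]
    ring

theorem val_expand (l n : ℕ) : val (expand k l n) = n % k ^ l := by
  induction l generalizing n with
  | zero => simp [expand, val, Nat.mod_one]
  | succ l ih =>
    rw [expand, val_append_singleton, ih, pow_succ', Nat.mod_mul]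
    simp [Fin.ofNat]
    ring

theorem expand_val (w : List (Fin k)) : expand k w.length (val w) = w := by
  induction w using List.reverseRecOn with
  | nil => rfl
  | append_singleton w j ih =>
    have hk : 0 < k := Nat.pos_of_neZero k
    rw [List.length_append, List.length_singleton, expand, val_append_singleton]
    have h1 : (val w * k + j) / k = val w := by
      rw [mul_comm, Nat.mul_add_div hk, Nat.div_eq_of_lt j.2, add_zero]
    have h2 : Fin.ofNat k (val w * k + j) = j := by
      ext
      simp [Fin.ofNat, Nat.mod_eq_of_lt j.2]
    rw [h1, h2, ih]

theorem val_lt (w : List (Fin k)) : val w < k ^ w.length := by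
  have h := val_expand (k := k) w.length (val w)
  rw [expand_val] at h
  rw [h]
  exact Nat.mod_lt _ (pow_pos (Nat.pos_of_neZero k) _)

theorem expand_zero (l : ℕ) : expand k l 0 = List.replicate l 0 := by
  induction l with
  | zero => rfl
  | succ l ih => rw [expand, Nat.zero_div, ih, List.replicate_succ']; rfl

theorem expand_add (l m n : ℕ) : expand k (l + m) n = expand k l (n / k ^ m) ++ expand k m n := by
  induction m generalizing n with
  | zero => simp [expand]
  | succ m ih =>
    rw [← add_assoc, expand, ih, expand, Nat.div_div_eq_div_mul, pow_succ', List.append_assoc]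

theorem expand_mul_pow_add (l q n : ℕ) : expand k l (q * k ^ l + n) = expand k l n := by
  have h : ∀ m, expand k l m = expand k l (m % k ^ l) := fun m => by
    conv_lhs => rw [← expand_val (expand k l m), length_expand, val_expand]
  rw [h, Nat.mul_add_mod_self_right, ← h]

/-- The expansion of `q * k ^ m + n`, with `n` of `m` digits, is read off from those of `q`
and `n`. -/
theorem expand_concat (l q : ℕ) {m n : ℕ} (h : n < k ^ m) :
    expand k (l + m) (q * k ^ m + n) = expand k l q ++ expand k m n := by
  rw [expand_add, expand_mul_pow_add, mul_comm, Nat.mul_add_div (pow_pos (Nat.pos_of_neZero k) _),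
    Nat.div_eq_of_lt h, add_zero]

omit [NeZero k] in
theorem mul_pow_add_lt {a b q n : ℕ} (hq : q < k ^ a) (hn : n < k ^ b) :
    q * k ^ b + n < k ^ (a + b) := by
  calc q * k ^ b + n < q * k ^ b + k ^ b := by omega
    _ = (q + 1) * k ^ b := by ring
    _ ≤ k ^ a * k ^ b := Nat.mul_le_mul_right _ hq
    _ = k ^ (a + b) := (pow_add _ _ _).symm

end Expansions

/-! ### Reading words -/

section Reading

variable {k : ℕ} {S G : Type*} [Group G] (T : GEA k S G)

omit [Group G] in
theorem stepWord_append (s : S) (u w : List (Fin k)) :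
    T.stepWord s (u ++ w) = T.stepWord (T.stepWord s u) w :=
  List.foldl_append

theorem labWord_append (s : S) (u w : List (Fin k)) :
    T.labWord s (u ++ w) = T.labWord s u * T.labWord (T.stepWord s u) w := by
  induction u generalizing s with
  | nil => simp [labWord, stepWord]
  | cons j u ih => simp only [List.cons_append, labWord, ih, mul_assoc]; rfl

/-- Every state is sent by `z` to the initial state, with trivial label. -/
def IsResetWord (z : List (Fin k)) : Prop :=
  ∀ s : S, T.stepWord s z = T.init ∧ T.labWord s z = 1

variable [NeZero k]

/-- The label of the base-`k` expansion of `n`, read from the initial state.  The length `n` of the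
expansion is only chosen to be long enough, see `labWord_expand`. -/
def seq (n : ℕ) : G := T.labWord T.init (expand k n n)

variable {T}

theorem Prolongable.stepWord_expand_zero (hP : T.Prolongable) (l : ℕ) :
    T.stepWord T.init (expand k l 0) = T.init := by
  rw [expand_zero]
  induction l with
  | zero => rfl
  | succ l ih => rw [List.replicate_succ, stepWord, List.foldl_cons, hP.1]; exact ih

theorem labWord_expand_zero (h0 : ∀ s, T.lab s 0 = 1) (s : S) (l : ℕ) :
    T.labWord s (expand k l 0) = 1 := by
  rw [expand_zero]
  induction l generalizing s with
  | zero => rfl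
  | succ l ih => rw [List.replicate_succ, labWord, h0, ih, one_mul]

theorem Prolongable.labWord_expand_of_le (hP : T.Prolongable) (h0 : ∀ s, T.lab s 0 = 1)
    {l m n : ℕ} (hn : n < k ^ l) (hlm : l ≤ m) :
    T.labWord T.init (expand k m n) = T.labWord T.init (expand k l n) := by
  obtain ⟨p, rfl⟩ := Nat.exists_eq_add_of_le' hlm
  rw [expand_add, Nat.div_eq_of_lt hn, labWord_append, labWord_expand_zero h0,
    hP.stepWord_expand_zero, one_mul]

theorem Prolongable.labWord_expand (hP : T.Prolongable) (h0 : ∀ s, T.lab s 0 = 1) (hk : 2 ≤ k)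
    {l n : ℕ} (hn : n < k ^ l) : T.labWord T.init (expand k l n) = T.seq n := by
  rcases le_total l n with h | h
  · exact (hP.labWord_expand_of_le h0 hn h).symm
  · exact hP.labWord_expand_of_le h0 (Nat.lt_pow_self hk) h

end Reading

section Sequence

variable {k : ℕ} [NeZero k] {S G : Type*} [Group G] {T : GEA k S G} {d' : ℕ} {G₀ : Subgroup G}
  {g₀ : G}

namespace IsEfficientWith

theorem labWord_expand (hT : T.IsEfficientWith d' G₀ g₀) (hk : 2 ≤ k) {l n : ℕ}
    (hn : n < k ^ l) : T.labWord T.init (expand k l n) = T.seq n :=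
  hT.idempotent.1.labWord_expand hT.lab_zero hk hn

theorem labWord_init (hT : T.IsEfficientWith d' G₀ g₀) (hk : 2 ≤ k) (w : List (Fin k)) :
    T.labWord T.init w = T.seq (val w) := by
  rw [← hT.labWord_expand hk (val_lt w), expand_val]

theorem seq_zero (hT : T.IsEfficientWith d' G₀ g₀) : T.seq 0 = 1 := by
  rw [seq, labWord_expand_zero hT.lab_zero]

theorem seq_mul_pow (hT : T.IsEfficientWith d' G₀ g₀) (hk : 2 ≤ k) (n j : ℕ) :
    T.seq (n * k ^ j) = T.seq n := by
  have hn : n < k ^ n := Nat.lt_pow_self hk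
  have h0 : 0 < k ^ j := pow_pos (Nat.pos_of_neZero k) _
  have h := expand_concat (k := k) n n h0
  rw [← add_zero (n * k ^ j), ← hT.labWord_expand hk (mul_pow_add_lt hn h0), h, labWord_append,
    labWord_expand_zero hT.lab_zero, mul_one, hT.labWord_expand hk hn]

/-- A reset word in the middle of an expansion decouples the digits before it from those after. -/
theorem seq_concat (hT : T.IsEfficientWith d' G₀ g₀) (hk : 2 ≤ k) {z : List (Fin k)}
    (hz : T.IsResetWord z) (n : ℕ) {l m : ℕ} (hm : m < k ^ l) :
    T.seq ((n * k ^ z.length + val z) * k ^ l + m) = T.seq n * T.seq m := by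
  have hn : n < k ^ n := Nat.lt_pow_self hk
  rw [← hT.labWord_expand hk (mul_pow_add_lt (mul_pow_add_lt hn (val_lt z)) hm),
    expand_concat _ _ hm, expand_concat _ _ (val_lt z), expand_val, labWord_append, labWord_append,
    stepWord_append, (hz _).1, (hz _).2, mul_one, hT.labWord_expand hk hn,
    hT.labWord_expand hk hm]

theorem seq_add_shift (hT : T.IsEfficientWith d' G₀ g₀) (hk : 2 ≤ k) {z : List (Fin k)}
    (hz : T.IsResetWord z) {l m : ℕ} (hm : m < k ^ l) :
    T.seq (val z * k ^ l + m) = T.seq m := by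
  simpa [hT.seq_zero] using hT.seq_concat hk hz 0 hm

theorem exists_isResetWord (hT : T.IsEfficientWith d' G₀ g₀) (hk : 2 ≤ k) :
    ∃ z : List (Fin k), T.IsResetWord z ∧ 0 < val z := by
  obtain ⟨w, hw⟩ := hT.synchronising
  -- A synchronising word may consist of zeros only; a loop at the initial state with leading
  -- digit `1` and trivial label is appended to make its value positive.
  let j : Fin k := ⟨1, hk⟩
  obtain ⟨l, hl⟩ := hT.labels_full (T.step T.init j) T.init
  obtain ⟨u, -, hu, hu'⟩ : (T.lab T.init j)⁻¹ ∈ _ := (hl l le_rfl).symm ▸ Set.mem_univ _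
  refine ⟨w ++ j :: u, fun s => ?_, ?_⟩
  · rw [stepWord_append, labWord_append, (hw s).1, (hw s).2, labWord, hu', stepWord, List.foldl_cons]
    exact ⟨hu, by simp⟩
  · have h1 : val [j] = 1 := by simp [val, j]
    rw [val_append, ← List.singleton_append, val_append [j], h1]
    have : 0 < k ^ u.length := pow_pos (Nat.pos_of_neZero k) _
    omega

theorem seq_surjective (hT : T.IsEfficientWith d' G₀ g₀) (hk : 2 ≤ k) :
    Function.Surjective T.seq := fun g => by
  obtain ⟨l, hl⟩ := hT.labels_full T.init T.init
  obtain ⟨u, -, -, hu'⟩ : g ∈ _ := (hl l le_rfl).symm ▸ Set.mem_univ g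
  exact ⟨val u, by rw [← hT.labWord_init hk, hu']⟩

theorem pos (hT : T.IsEfficientWith d' G₀ g₀) (hk : 2 ≤ k) : 0 < d' := by
  obtain ⟨l, hl⟩ := hT.gcd_values T.init T.init 1 G₀.one_mem
  have h := (hl l le_rfl).1.1
  rcases Nat.eq_zero_or_pos d' with rfl | h'
  · rw [Nat.coprime_zero_left] at h
    omega
  · exact h'

end IsEfficientWith

end Sequence

/-! ### Labels modulo `G₀` -/

section Residue

variable {k : ℕ} [NeZero k] {S G : Type*} [Group G] {T : GEA k S G} {d' : ℕ} {G₀ : Subgroup G}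
  {g₀ : G}

namespace IsEfficientWith

/-- Leading zeros make the word long enough for the condition on greatest common divisors. -/
theorem dvd_val (hT : T.IsEfficientWith d' G₀ g₀) {w : List (Fin k)}
    (hs : T.stepWord T.init w = T.init) (hg : T.labWord T.init w ∈ G₀) : d' ∣ val w := by
  obtain ⟨l, hl⟩ := hT.gcd_values T.init T.init _ hg
  have h : expand k (l + w.length) (val w) = expand k l 0 ++ w := by
    have := expand_concat l 0 (val_lt w)
    rwa [zero_mul, zero_add, expand_val] at this
  refine (hl (l + w.length) (Nat.le_add_right _ _)).1.2 _ ⟨expand k (l + w.length) (val w),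
    length_expand _ _, ?_, ?_, ?_⟩
  · rw [h, stepWord_append, hT.idempotent.1.stepWord_expand_zero, hs]
  · rw [h, labWord_append, hT.idempotent.1.stepWord_expand_zero,
      labWord_expand_zero hT.lab_zero, one_mul]
  · rw [val_expand, Nat.mod_eq_of_lt]
    exact (val_lt w).trans_le (Nat.pow_le_pow_right (Nat.pos_of_neZero k) (Nat.le_add_left _ _))

theorem exists_labWord_eq (hT : T.IsEfficientWith d' G₀ g₀) (hk : 2 ≤ k) (s : S)
    (w : List (Fin k)) : ∃ h ∈ G₀, T.labWord s w = h * g₀ ^ (val w % d') := by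
  have h := (hT.labels_residue s (T.stepWord s w) (val w % d') (Nat.mod_lt _ (hT.pos hk))).1
  obtain ⟨x, hx, y, rfl, hxy⟩ : T.labWord s w ∈ (G₀ : Set G) * {g₀ ^ (val w % d')} :=
    h ▸ ⟨w, rfl, (Nat.mod_modEq _ _).symm, rfl⟩
  exact ⟨x, hx, hxy.symm⟩

theorem exists_word (hT : T.IsEfficientWith d' G₀ g₀) {r : ℕ} (hr : r < d') {x : G}
    (hx : x ∈ G₀) : ∃ w : List (Fin k), T.stepWord T.init w = T.init ∧ val w ≡ r [MOD d'] ∧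
      T.labWord T.init w = x * g₀ ^ r := by
  have h : x * g₀ ^ r ∈ (G₀ : Set G) * {g₀ ^ r} := ⟨x, hx, _, rfl, rfl⟩
  rwa [← (hT.labels_residue T.init T.init r hr).1] at h

theorem normal (hT : T.IsEfficientWith d' G₀ g₀) (hk : 2 ≤ k) : G₀.Normal := by
  refine ⟨fun n hn g => ?_⟩
  obtain ⟨m, rfl⟩ := hT.seq_surjective hk g
  obtain ⟨h, hh, e⟩ := hT.exists_labWord_eq hk T.init (expand k m m)
  have hr := Nat.mod_lt (val (expand k m m)) (hT.pos hk)
  rw [← seq] at e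
  generalize val (expand k m m) % d' = r at e hr
  obtain ⟨x, hx, y, rfl, hxy⟩ : g₀ ^ r * n ∈ (G₀ : Set G) * {g₀ ^ r} := by
    rw [(hT.labels_residue T.init T.init r hr).2]
    exact ⟨_, rfl, n, hn, rfl⟩
  have : T.seq m * n * (T.seq m)⁻¹ = h * x * h⁻¹ := by
    rw [e, mul_assoc h, ← hxy]
    group
  rw [this]
  exact G₀.mul_mem (G₀.mul_mem hh hx) (G₀.inv_mem hh)

/-- The cosets `G₀ g₀ ^ r` are separated by the values of the words carrying them, so `g₀` has
order `d'` modulo `G₀`. -/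
theorem pow_mem_iff (hT : T.IsEfficientWith d' G₀ g₀) (hk : 2 ≤ k) (n : ℕ) :
    g₀ ^ n ∈ G₀ ↔ d' ∣ n := by
  have hsmall : ∀ r < d', g₀ ^ r ∈ G₀ → r = 0 := fun r hr h => by
    obtain ⟨w, hw, hwr, hl⟩ := hT.exists_word hr G₀.one_mem
    rw [one_mul] at hl
    exact Nat.eq_zero_of_dvd_of_lt (hwr.symm.dvd_iff dvd_rfl |>.2 (hT.dvd_val hw (hl ▸ h))) hr
  have hd : g₀ ^ d' ∈ G₀ := by
    obtain ⟨m, hm⟩ := hT.seq_surjective hk (g₀ ^ d')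
    obtain ⟨h, hh, e⟩ := hT.exists_labWord_eq hk T.init (expand k m m)
    have hr := Nat.mod_lt (val (expand k m m)) (hT.pos hk)
    rw [← seq, hm] at e
    generalize val (expand k m m) % d' = r at e hr
    rcases Nat.eq_zero_or_pos r with rfl | hr0
    · rw [e]
      simpa using hh
    · have h1 : g₀ ^ (d' - r) ∈ G₀ := by
        rw [pow_sub _ hr.le, e, mul_inv_cancel_right]
        exact hh
      have := hsmall _ (by omega) h1
      omega
  have hdiv : g₀ ^ n ∈ G₀ ↔ g₀ ^ (n % d') ∈ G₀ := by
    conv_lhs => rw [← Nat.div_add_mod n d', pow_add, pow_mul]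
    exact G₀.mul_mem_cancel_left (G₀.pow_mem hd _)
  rw [hdiv, Nat.dvd_iff_mod_eq_zero]
  refine ⟨hsmall _ (Nat.mod_lt _ (hT.pos hk)), fun h => ?_⟩
  rw [h, pow_zero]
  exact G₀.one_mem

/-- `G₀` is the kernel of a homomorphism onto `ℤ/d'ℤ` which sends the label of every word to the
value of that word. -/
theorem exists_residueHom (hT : T.IsEfficientWith d' G₀ g₀) (hk : 2 ≤ k) :
    ∃ π : G →* Multiplicative (ZMod d'), π.ker = G₀ ∧ π g₀ = Multiplicative.ofAdd 1 ∧
      ∀ (s : S) (w : List (Fin k)),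
        π (T.labWord s w) = Multiplicative.ofAdd ((val w : ℕ) : ZMod d') := by
  have := hT.normal hk
  let q : G →* G ⧸ G₀ := QuotientGroup.mk' G₀
  have hq : ∀ x, q x = 1 ↔ x ∈ G₀ := fun x => QuotientGroup.eq_one_iff x
  have hlab : ∀ (s : S) (w : List (Fin k)), q (T.labWord s w) = q g₀ ^ (val w % d') :=
    fun s w => by
      obtain ⟨h, hh, e⟩ := hT.exists_labWord_eq hk s w
      rw [e, map_mul, (hq h).2 hh, one_mul, map_pow]
  have hord : orderOf (q g₀) = d' := Nat.dvd_right_iff_eq.1 fun n => by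
    rw [orderOf_dvd_iff_pow_eq_one, ← map_pow, hq, hT.pow_mem_iff hk]
  have hex : ∀ x, ∃ r : ℕ, q x = q g₀ ^ r := fun x => by
    obtain ⟨m, rfl⟩ := hT.seq_surjective hk x
    exact ⟨_, hlab _ _⟩
  choose r hr using hex
  have hcast : ∀ m n : ℕ, q g₀ ^ m = q g₀ ^ n ↔ (m : ZMod d') = n := fun m n => by
    rw [pow_eq_pow_iff_modEq, hord, ZMod.natCast_eq_natCast_iff]
  refine ⟨MonoidHom.mk' (fun x => Multiplicative.ofAdd (r x : ZMod d')) fun x y => ?_, ?_, ?_, ?_⟩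
  · rw [← ofAdd_add, ← Nat.cast_add, Multiplicative.ofAdd.injective.eq_iff, ← hcast, ← hr, map_mul,
      pow_add, ← hr, ← hr]
  · ext x
    rw [MonoidHom.mem_ker, MonoidHom.mk'_apply, ← ofAdd_zero, Multiplicative.ofAdd.injective.eq_iff,
      ← Nat.cast_zero, ← hcast, ← hr, pow_zero, hq]
  · rw [MonoidHom.mk'_apply, Multiplicative.ofAdd.injective.eq_iff, ← Nat.cast_one, ← hcast, ← hr,
      pow_one]
  · intro s w
    rw [MonoidHom.mk'_apply, Multiplicative.ofAdd.injective.eq_iff, ← hcast, ← hr, hlab, hcast,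
      ZMod.natCast_mod]

/-- Appending a zero multiplies the value by `k` and keeps the label, so `k` is `1` modulo `d'`. -/
theorem natCast_eq_one (hT : T.IsEfficientWith d' G₀ g₀) (hk : 2 ≤ k) : (k : ZMod d') = 1 := by
  obtain ⟨π, -, -, hπ⟩ := hT.exists_residueHom hk
  let j : Fin k := ⟨1, hk⟩
  have h1 := hπ T.init [j]
  have h2 := hπ T.init [j, 0]
  have h3 : T.labWord T.init [j, 0] = T.labWord T.init [j] := by simp [labWord, hT.lab_zero]
  rw [h3, h1, Multiplicative.ofAdd.injective.eq_iff] at h2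
  simpa [val, j, Nat.ofDigits_cons] using h2.symm

end IsEfficientWith

end Residue

/-! ### Recurrent and multiplicative sequences -/

/-- A sequence in a finite set in which any `d` consecutive terms determine the next one is
eventually periodic. -/
theorem exists_period_of_recurrence {α : Type*} [Finite α] (f : ℕ → α) (d : ℕ)
    (h : ∀ n n', (∀ i < d, f (n + i) = f (n' + i)) → f (n + d) = f (n' + d)) :
    ∃ n₀ M, 0 < M ∧ ∀ n ≥ n₀, f (n + M) = f n := by
  obtain ⟨a, b, hab, hw⟩ :=
    Finite.exists_ne_map_eq_of_infinite (fun n (i : Fin d) => f (n + i))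
  wlog hlt : a < b generalizing a b
  · exact this b a hab.symm hw.symm (by omega)
  have key : ∀ t, ∀ i < d, f (a + t + i) = f (b + t + i) := by
    intro t
    induction t with
    | zero => exact fun i hi => congrFun hw ⟨i, hi⟩
    | succ t ih =>
      intro i hi
      rcases Nat.lt_or_ge (i + 1) d with h1 | h1
      · have := ih (i + 1) h1
        rwa [← add_assoc, ← add_assoc, add_right_comm _ i, add_right_comm _ i] at this
      · have := h _ _ ih
        obtain rfl : d = i + 1 := by omega
        rwa [← add_assoc, ← add_assoc, add_right_comm _ i, add_right_comm _ i] at this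
  -- Read off at the end of the window, which also covers `d = 0`.
  refine ⟨a + d, b - a, by omega, fun n hn => ?_⟩
  have := h _ _ (key (n - (a + d)))
  rw [show a + (n - (a + d)) + d = n by omega] at this
  rw [this]
  congr 1
  omega

/-- An eventually periodic sequence which is invariant under multiplication by `k` and
multiplicative across one block of digits with value `Z` is a homomorphism. -/
theorem map_add_of_eventually_periodic {Γ : Type*} [Group Γ] {k : ℕ} (hk : 2 ≤ k) {f : ℕ → Γ}
    {n₀ M : ℕ} (hM : 0 < M) (hper : ∀ n ≥ n₀, f (n + M) = f n) (h0 : f 0 = 1)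
    (hpow : ∀ n j, f (n * k ^ j) = f n) {i Z : ℕ} (hZ : 0 < Z)
    (hconcat : ∀ n l m, m < k ^ l → f ((n * k ^ i + Z) * k ^ l + m) = f n * f m) (n m : ℕ) :
    f (n + m) = f n * f m := by
  have hper' : ∀ q, ∀ x ≥ n₀, f (x + q * M) = f x := by
    intro q
    induction q with
    | zero => simp
    | succ q ih =>
      intro x hx
      rw [Nat.succ_mul, ← add_assoc, hper _ (by omega), ih x hx]
  have hmod : ∀ x y, n₀ ≤ x → n₀ ≤ y → x ≡ y [MOD M] → f x = f y := by
    intro x y hx hy hxy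
    wlog hle : x ≤ y generalizing x y
    · exact (this y x hy hx hxy.symm (by omega)).symm
    obtain ⟨q, hq⟩ := (Nat.modEq_iff_dvd' hle).1 hxy
    rw [show y = x + q * M by rw [mul_comm q, ← hq]; omega, hper' q x hx]
  -- A power `u = k ^ t` which is idempotent modulo `M` and exceeds the preperiod.
  obtain ⟨t, ht0, htn, hidem⟩ : ∃ t, 0 < t ∧ n₀ ≤ k ^ t ∧ k ^ t * k ^ t ≡ k ^ t [MOD M] := by
    have : NeZero M := ⟨hM.ne'⟩
    obtain ⟨a, b, hab, hw⟩ := Finite.exists_ne_map_eq_of_infinite fun n => ((k ^ n : ℕ) : ZMod M)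
    wlog hlt : a < b generalizing a b
    · exact this b a hab.symm hw.symm (by omega)
    have hstep : ∀ q, ∀ x ≥ a, ((k ^ (x + q * (b - a)) : ℕ) : ZMod M) = (k ^ x : ℕ) := by
      intro q
      induction q with
      | zero => simp
      | succ q ih =>
        intro x hx
        have e1 : x + (q + 1) * (b - a) = (x + q * (b - a) - a) + b := by
          rw [Nat.succ_mul]
          omega
        have e2 : x + q * (b - a) = (x + q * (b - a) - a) + a := by omega
        rw [← ih x hx, e1, e2, pow_add, Nat.cast_mul, ← hw]
        simp only [Nat.add_sub_cancel, pow_add, Nat.cast_mul]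
    have hp : 0 < b - a := by omega
    have ht : a + n₀ + 1 ≤ (a + n₀ + 1) * (b - a) := Nat.le_mul_of_pos_right _ hp
    refine ⟨(a + n₀ + 1) * (b - a), by omega, ?_, ?_⟩
    · exact (show n₀ ≤ (a + n₀ + 1) * (b - a) by omega).trans (Nat.lt_pow_self hk).le
    · rw [← ZMod.natCast_eq_natCast_iff, ← pow_add]
      exact hstep _ _ (by omega)
  have hr : ∀ r, k ^ (t * (r + 1)) ≡ k ^ t [MOD M] := by
    intro r
    induction r with
    | zero => simpa using Nat.ModEq.refl _
    | succ r ih =>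
      rw [mul_add, pow_add, mul_one]
      exact (ih.mul_right _).trans hidem
  have main : ∀ n m, f n * f m = f (n + Z + m) := by
    intro n m
    set u := k ^ t with hu
    have hu0 : 0 < u := pow_pos (by omega) _
    -- Lengths divisible by `t` make all powers of `k` in the concatenation congruent to `u`.
    have hml : m * u < k ^ (t * (m * u + 1)) :=
      (Nat.lt_pow_self hk).trans_le (Nat.pow_le_pow_right (by omega)
        ((Nat.le_succ _).trans (Nat.le_mul_of_pos_left _ ht0)))
    have hti : i ≤ t * i := Nat.le_mul_of_pos_left _ ht0
    have e := hconcat (n * k ^ (t * i - i)) (t * (m * u + 1)) (m * u) hml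
    rw [hpow, hpow m t] at e
    have e2 : (n * k ^ (t * i - i) * k ^ i + Z) * k ^ (t * (m * u + 1)) + m * u =
        n * k ^ (t * (i + m * u + 1)) + Z * k ^ (t * (m * u + 1)) + m * u := by
      rw [mul_assoc n, ← pow_add, Nat.sub_add_cancel hti, add_mul, mul_assoc n, ← pow_add]
      congr 4
      ring
    rw [← e, e2, ← hpow (n + Z + m) t]
    have hbig : u ≤ k ^ (t * (m * u + 1)) :=
      Nat.pow_le_pow_right (by omega) (Nat.le_mul_of_pos_right _ (by omega))
    apply hmod
    · have := Nat.le_mul_of_pos_left (k ^ (t * (m * u + 1))) hZ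
      omega
    · exact htn.trans (Nat.le_mul_of_pos_left _ (by omega))
    · rw [add_mul, add_mul]
      exact (((hr _).mul_left n).add ((hr _).mul_left Z)).add_right _
  have hshift : ∀ n, f (n + Z) = f n := fun n => by
    have := main n 0
    rw [h0, mul_one] at this
    exact this.symm
  rw [main, add_right_comm, hshift]

/-! ### Linear forms on the cube -/

section Dot

variable {d : ℕ}

theorem dot_add {M : Type*} [AddCommMonoid M] (ω : Vertex d) (e f : Fin (d + 1) → M) :
    dot ω (fun i => e i + f i) = dot ω e + dot ω f := by
  simp only [dot, smul_add, Finset.sum_add_distrib]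
  exact add_add_add_comm _ _ _ _

theorem dot_sub {M : Type*} [AddCommGroup M] (ω : Vertex d) (e f : Fin (d + 1) → M) :
    dot ω (fun i => e i - f i) = dot ω e - dot ω f := by
  simp only [dot, smul_sub, Finset.sum_sub_distrib]
  abel

theorem dot_mul_const (ω : Vertex d) (e : Fin (d + 1) → ℕ) (c : ℕ) :
    dot ω (fun i => e i * c) = dot ω e * c := by
  simp only [dot, add_mul, Finset.sum_mul, smul_eq_mul, mul_assoc]

theorem dot_single_zero (ω : Vertex d) (c : ℕ) : dot ω (Pi.single 0 c) = c := by
  simp [dot]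

theorem dot_natCast {R : Type*} [Semiring R] (ω : Vertex d) (e : Fin (d + 1) → ℕ) :
    dot ω (fun i => (e i : R)) = (dot ω e : ℕ) := by
  simp [dot]

theorem dot_le_dot_one (ω : Vertex d) (e : Fin (d + 1) → ℕ) : dot ω e ≤ dot (fun _ => 1) e := by
  refine Nat.add_le_add_left (Finset.sum_le_sum fun j _ => Nat.mul_le_mul_right _ ?_) _
  exact Nat.le_of_lt_succ (ω j).2

theorem le_dot_one (e : Fin (d + 1) → ℕ) (i : Fin (d + 1)) : e i ≤ dot (fun _ => 1) e := by
  refine Fin.cases ?_ (fun j => ?_) i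
  · exact Nat.le_add_right _ _
  · refine le_trans ?_ (Nat.le_add_left _ _)
    simpa using Finset.single_le_sum (f := fun j : Fin d => e j.succ) (fun _ _ => Nat.zero_le _)
      (Finset.mem_univ j)

/-- The linear form of the vector `(n, 1, …, 1)` takes the values `n, …, n + d`, the last of them
at the vertex `(1, …, 1)` only. -/
theorem dot_cons_one (ω : Vertex d) (n : ℕ) :
    dot ω (Fin.cons n fun _ => 1 : Fin (d + 1) → ℕ) = n + ∑ j, (ω j : ℕ) := by
  simp [dot]

theorem sum_vertex_lt {ω : Vertex d} (hω : ω ≠ fun _ => 1) : ∑ j, (ω j : ℕ) < d := by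
  obtain ⟨j, hj⟩ : ∃ j, ω j ≠ 1 := by
    by_contra! h
    exact hω (funext h)
  calc ∑ j, (ω j : ℕ) < ∑ _j : Fin d, 1 :=
        Finset.sum_lt_sum (fun i _ => by omega) ⟨j, Finset.mem_univ _, by omega⟩
    _ = d := by simp

/-- The reflection of the cube in the `j`-th coordinate. -/
def reflect (j : Fin d) (ω : Vertex d) : Vertex d := Function.update ω j (ω j).rev

theorem reflect_reflect (j : Fin d) (ω : Vertex d) : reflect j (reflect j ω) = ω := by
  simp [reflect]

theorem dot_reflect (j : Fin d) (ω : Vertex d) (e : Fin (d + 1) → ℕ) {X : ℕ}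
    (hX : e j.succ ≤ X) :
    dot (reflect j ω) (Fin.cons (e 0 + e j.succ)
      (Function.update (fun i : Fin d => e i.succ) j (X - e j.succ)) : Fin (d + 1) → ℕ) =
    (1 - (ω j : ℕ)) * X + dot ω e := by
  have hrest : ∑ i ∈ Finset.univ.erase j, (reflect j ω i : ℕ) •
      Function.update (fun i : Fin d => e i.succ) j (X - e j.succ) i =
      ∑ i ∈ Finset.univ.erase j, (ω i : ℕ) • e i.succ :=
    Finset.sum_congr rfl fun i hi => by
      have := Finset.ne_of_mem_erase hi
      simp [reflect, this]
  rw [dot, dot, ← Finset.add_sum_erase _ _ (Finset.mem_univ j),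
    ← Finset.add_sum_erase _ (fun i : Fin d => (ω i : ℕ) • e i.succ) (Finset.mem_univ j)]
  simp only [Fin.cons_succ, Fin.cons_zero, hrest]
  generalize ∑ i ∈ Finset.univ.erase j, (ω i : ℕ) • e i.succ = c
  have h2 : (reflect j ω j : ℕ) = 1 - (ω j : ℕ) := by
    simp [reflect, Fin.val_rev]
  rw [h2, Function.update_self]
  rcases (show (ω j : ℕ) = 0 ∨ (ω j : ℕ) = 1 by omega) with h | h <;> rw [h] <;> simp <;> omega

/-- A property of vertices which is invariant under reflections holds at all vertices as soon as it
holds at `(1, …, 1)`. -/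
theorem forall_of_reflect {p : Vertex d → Prop} (h1 : p fun _ => 1)
    (hp : ∀ j ω, p ω → p (reflect j ω)) (ω : Vertex d) : p ω := by
  have key : ∀ s : Finset (Fin d), p fun j => if j ∈ s then 0 else 1 := by
    intro s
    induction s using Finset.induction_on with
    | empty => simpa using h1
    | insert a s ha ih =>
      convert hp a _ ih using 1
      funext j
      by_cases hj : j = a
      · subst hj
        simp [reflect, ha]
      · simp [reflect, hj]
  convert key (Finset.univ.filter fun j => ω j = 0) using 1
  funext j
  rcases Fin.exists_fin_two.1 ⟨ω j, rfl⟩ with h | h <;> simp [h]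

end Dot

/-! ### The group of cubes of the label sequence -/

section CubeGroup

variable {k : ℕ} [NeZero k] {S G : Type*} [Group G] [Finite G] {T : GEA k S G} {d' : ℕ}
  {G₀ : Subgroup G} {g₀ : G}

namespace IsEfficientWith

omit [Finite G] in
/-- A reset word, inserted in the constant coefficient, lies between the digits of `1ω · e` and
`1ω · f` at all vertices at once. -/
theorem exists_seq_mul (hT : T.IsEfficientWith d' G₀ g₀) (hk : 2 ≤ k) {d : ℕ}
    (e f : Fin (d + 1) → ℕ) : ∃ e' : Fin (d + 1) → ℕ, ∀ ω : Vertex d,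
      T.seq (dot ω e') = T.seq (dot ω e) * T.seq (dot ω f) := by
  obtain ⟨z, hz, -⟩ := hT.exists_isResetWord hk
  let l := dot (fun _ => 1) f
  refine ⟨fun i => (e i * k ^ z.length + (Pi.single 0 (val z) : Fin (d + 1) → ℕ) i) * k ^ l + f i,
    fun ω => ?_⟩
  rw [dot_add, dot_mul_const, dot_add, dot_mul_const, dot_single_zero]
  exact hT.seq_concat hk hz _ ((dot_le_dot_one ω f).trans_lt (Nat.lt_pow_self hk))

/-- The group of all cubes `(a(1ω · e))_ω`, where `a` is the label sequence `T.seq`. -/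
def cubeGroup (hT : T.IsEfficientWith d' G₀ g₀) (hk : 2 ≤ k) (d : ℕ) :
    Subgroup (Vertex d → G) :=
  have hmul : ∀ x y : Vertex d → G, (∃ e, ∀ ω, x ω = T.seq (dot ω e)) →
      (∃ e, ∀ ω, y ω = T.seq (dot ω e)) → ∃ e, ∀ ω, (x * y) ω = T.seq (dot ω e) := by
    rintro x y ⟨e, he⟩ ⟨f, hf⟩
    obtain ⟨e', he'⟩ := hT.exists_seq_mul hk e f
    exact ⟨e', fun ω => by rw [he', ← he, ← hf, Pi.mul_apply]⟩
  have hone : ∃ e, ∀ ω, (1 : Vertex d → G) ω = T.seq (dot ω e) :=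
    ⟨Pi.single 0 0, fun ω => by rw [dot_single_zero, hT.seq_zero, Pi.one_apply]⟩
  { carrier := {x | ∃ e, ∀ ω, x ω = T.seq (dot ω e)}
    one_mem' := hone
    mul_mem' := fun {x y} hx hy => hmul x y hx hy
    -- As `G` is finite, inverses are powers.
    inv_mem' := fun {x} hx => by
      have hpow : ∀ n, ∃ e, ∀ ω, (x ^ n) ω = T.seq (dot ω e) := fun n => by
        induction n with
        | zero => simpa using hone
        | succ n ih => rw [pow_succ]; exact hmul _ _ ih hx
      have hinv : x⁻¹ = x ^ (orderOf x - 1) := by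
        rw [inv_eq_iff_mul_eq_one, ← pow_succ', Nat.sub_add_cancel (orderOf_pos x),
          pow_orderOf_eq_one]
      rw [hinv]
      exact hpow _ }

theorem const_mem_cubeGroup (hT : T.IsEfficientWith d' G₀ g₀) (hk : 2 ≤ k) (d : ℕ) (g : G) :
    (fun _ => g) ∈ hT.cubeGroup hk d := by
  obtain ⟨n, rfl⟩ := hT.seq_surjective hk g
  exact ⟨Pi.single 0 n, fun ω => by rw [dot_single_zero]⟩

/-- The direction of an edge can be reversed because a far-away reset word, worth `X`, shifts the
label sequence without changing its initial terms: `(n, n + h)` becomes `(n + h, n + X)`. -/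
theorem reflect_mem_cubeGroup (hT : T.IsEfficientWith d' G₀ g₀) (hk : 2 ≤ k) {d : ℕ}
    {x : Vertex d → G} (hx : x ∈ hT.cubeGroup hk d) (j : Fin d) :
    (fun ω => x (reflect j ω)) ∈ hT.cubeGroup hk d := by
  obtain ⟨e, he⟩ := hx
  obtain ⟨z, hz, hz0⟩ := hT.exists_isResetWord hk
  let l := dot (fun _ => 1) e
  have hX : e j.succ ≤ val z * k ^ l :=
    (le_dot_one e j.succ).trans ((Nat.lt_pow_self hk).le.trans (Nat.le_mul_of_pos_left _ hz0))
  refine ⟨Fin.cons (e 0 + e j.succ)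
    (Function.update (fun i : Fin d => e i.succ) j (val z * k ^ l - e j.succ)), fun ω => ?_⟩
  have h := dot_reflect j (reflect j ω) e hX
  rw [reflect_reflect] at h
  refine (he _).trans ?_
  rw [h]
  rcases (show 1 - (reflect j ω j : ℕ) = 0 ∨ 1 - (reflect j ω j : ℕ) = 1 by omega) with h | h
  · rw [h, zero_mul, zero_add]
  · rw [h, one_mul, hT.seq_add_shift hk hz]
    exact (dot_le_dot_one _ e).trans_lt (Nat.lt_pow_self hk)

/-- The elements of `G` that may be changed at the vertex `(1, …, 1)` without leaving the cube
group. -/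
def cornerGroup (hT : T.IsEfficientWith d' G₀ g₀) (hk : 2 ≤ k) (d : ℕ) : Subgroup G :=
  (hT.cubeGroup hk d).comap (MonoidHom.mulSingle (fun _ : Vertex d => G) fun _ => 1)

theorem cornerGroup_normal (hT : T.IsEfficientWith d' G₀ g₀) (hk : 2 ≤ k) (d : ℕ) :
    (hT.cornerGroup hk d).Normal := by
  refine ⟨fun n hn g => ?_⟩
  have hc := hT.const_mem_cubeGroup hk d g
  have := mul_mem (mul_mem hc hn) (inv_mem hc)
  refine (congrArg (· ∈ hT.cubeGroup hk d) ?_).mp this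
  funext ω
  by_cases h : ω = fun _ => 1
  · subst h
    simp
  · simp [h]

/-- Reflections carry the vertex `(1, …, 1)` to any other, so the cubes with one nontrivial entry,
taken from the corner group, all lie in the cube group. -/
theorem pi_cornerGroup_le (hT : T.IsEfficientWith d' G₀ g₀) (hk : 2 ≤ k) (d : ℕ) :
    Subgroup.pi Set.univ (fun _ => hT.cornerGroup hk d) ≤ hT.cubeGroup hk d := by
  rw [Subgroup.pi_le_iff]
  rintro ω _ ⟨g, hg, rfl⟩
  refine forall_of_reflect (p := fun ω => Pi.mulSingle ω g ∈ hT.cubeGroup hk d) ?_ ?_ ω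
  · exact hg
  · intro j ω' h
    convert hT.reflect_mem_cubeGroup hk h j using 1
    funext ω''
    by_cases h' : ω'' = reflect j ω'
    · subst h'
      simp [reflect_reflect]
    · have : reflect j ω'' ≠ ω' := fun h'' => h' (by rw [← h'', reflect_reflect])
      simp [h', this]

/-- Modulo the corner group, the entry of a cube at `(1, …, 1)` is determined by the others. -/
theorem mk_corner_eq (hT : T.IsEfficientWith d' G₀ g₀) (hk : 2 ≤ k) {d : ℕ}
    {x y : Vertex d → G} (hx : x ∈ hT.cubeGroup hk d) (hy : y ∈ hT.cubeGroup hk d)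
    (hxy : ∀ ω, (ω ≠ fun _ => 1) → (x ω : G ⧸ hT.cornerGroup hk d) = y ω) :
    (x (fun _ => 1) : G ⧸ hT.cornerGroup hk d) = y fun _ => 1 := by
  let z : Vertex d → G := fun ω => if ω = fun _ => 1 then 1 else (x ω)⁻¹ * y ω
  have hz : z ∈ hT.cubeGroup hk d := by
    refine hT.pi_cornerGroup_le hk d fun ω _ => ?_
    by_cases h : ω = fun _ => 1
    · simp only [z, if_pos h]
      exact (hT.cornerGroup hk d).one_mem
    · simp only [z, if_neg h]
      exact QuotientGroup.eq.1 (hxy ω h)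
  rw [QuotientGroup.eq]
  have := mul_mem (inv_mem hz) (mul_mem (inv_mem hx) hy)
  refine (congrArg (· ∈ hT.cubeGroup hk d) ?_).mp this
  funext ω
  by_cases h : ω = fun _ => 1
  · subst h
    simp [z]
  · simp [z, h]

/-- Modulo the corner group the label sequence satisfies a recurrence of order `d`, given by the
cubes over `n, …, n + d`; hence it is eventually periodic, hence a homomorphism. -/
theorem mk_seq_add (hT : T.IsEfficientWith d' G₀ g₀) (hk : 2 ≤ k) (d n m : ℕ) :
    (T.seq (n + m) : G ⧸ hT.cornerGroup hk d) = (T.seq n * T.seq m : G) := by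
  have := hT.cornerGroup_normal hk d
  obtain ⟨n₀, M, hM, hper⟩ := exists_period_of_recurrence
    (fun n => (T.seq n : G ⧸ hT.cornerGroup hk d)) d fun n n' h => by
      have hmem : ∀ n, (fun ω : Vertex d => T.seq (n + ∑ j, (ω j : ℕ))) ∈ hT.cubeGroup hk d :=
        fun n => ⟨_, fun ω => congrArg T.seq (dot_cons_one ω n).symm⟩
      have := hT.mk_corner_eq hk (hmem n) (hmem n') fun ω hω => h _ (sum_vertex_lt hω)
      simpa using this
  obtain ⟨z, hz, hz0⟩ := hT.exists_isResetWord hk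
  exact map_add_of_eventually_periodic
    (f := fun n => (T.seq n : G ⧸ hT.cornerGroup hk d)) hk hM hper (congrArg _ hT.seq_zero)
    (fun n j => congrArg _ (hT.seq_mul_pow hk n j)) hz0
    (fun n l m hm => congrArg _ (hT.seq_concat hk hz n hm)) n m

/-- The homomorphism `n ↦ a(n)` modulo the corner group has a period `m` coprime to `k`, as
`a(k) = a(1)`, and `m` divides the values of all words with trivial label; so `m` divides `d'`. -/
theorem le_cornerGroup (hT : T.IsEfficientWith d' G₀ g₀) (hk : 2 ≤ k) (d : ℕ) :
    G₀ ≤ hT.cornerGroup hk d := by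
  have := hT.cornerGroup_normal hk d
  set K := hT.cornerGroup hk d
  have hseq : ∀ n, (T.seq n : G ⧸ K) = (T.seq 1 : G ⧸ K) ^ n := fun n => by
    induction n with
    | zero => rw [hT.seq_zero, pow_zero]; rfl
    | succ n ih => rw [hT.mk_seq_add hk, QuotientGroup.mk_mul, ih, pow_succ]
  set c := (T.seq 1 : G ⧸ K)
  have hmem : ∀ n, T.seq n ∈ K ↔ orderOf c ∣ n := fun n => by
    rw [orderOf_dvd_iff_pow_eq_one, ← hseq, QuotientGroup.eq_one_iff]
  have hcop : (orderOf c).Coprime k := by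
    have hck : c ^ k = c := by
      have := hT.seq_mul_pow hk 1 1
      rw [one_mul, pow_one] at this
      rw [← hseq, this]
    have hck' : c ^ (k - 1) = 1 := by
      refine mul_right_cancel (b := c) ?_
      rw [← pow_succ, Nat.sub_add_cancel (by omega), hck, one_mul]
    exact Nat.Coprime.coprime_dvd_left (orderOf_dvd_of_pow_eq_one hck')
      ((Nat.coprime_self_sub_left (by omega)).2 (Nat.coprime_one_left k))
  obtain ⟨l, hl⟩ := hT.gcd_values T.init T.init 1 G₀.one_mem
  obtain ⟨⟨hdk, hdv⟩, hmax⟩ := hl l le_rfl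
  have hlcm : (orderOf c).lcm d' ∈ {m : ℕ | m.Coprime k ∧ ∀ a ∈ {n : ℕ | ∃ w : List (Fin k),
      w.length = l ∧ T.stepWord T.init w = T.init ∧ T.labWord T.init w = 1 ∧ val w = n}, m ∣ a} := by
    refine ⟨(hcop.mul_left hdk).coprime_dvd_left (Nat.lcm_dvd_mul _ _), fun a ha => ?_⟩
    refine Nat.lcm_dvd ?_ (hdv a ha)
    obtain ⟨w, -, -, hw, rfl⟩ := ha
    rw [← hmem, ← hT.labWord_init hk, hw]
    exact one_mem _
  have hd : orderOf c ∣ d' := by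
    have h1 := hmax hlcm
    have h2 : (orderOf c).lcm d' = d' :=
      le_antisymm h1 (Nat.le_of_dvd (Nat.lcm_pos (orderOf_pos c) (hT.pos hk)) (Nat.dvd_lcm_right _ _))
    exact h2 ▸ Nat.dvd_lcm_left _ _
  intro g hg
  obtain ⟨w, -, hw, hwg⟩ := hT.exists_word (hT.pos hk) hg
  rw [pow_zero, mul_one, hT.labWord_init hk] at hwg
  rw [← hwg, hmem]
  exact hd.trans ((Nat.modEq_zero_iff_dvd).1 hw)

theorem pi_le_cubeGroup (hT : T.IsEfficientWith d' G₀ g₀) (hk : 2 ≤ k) (d : ℕ) :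
    Subgroup.pi Set.univ (fun _ => G₀) ≤ hT.cubeGroup hk d :=
  fun _ hx => hT.pi_cornerGroup_le hk d fun ω h => hT.le_cornerGroup hk d (hx ω h)

end IsEfficientWith

end CubeGroup

/-! ### Composition of cubes -/

section Composition

variable {k : ℕ} [NeZero k] {S G : Type*} [Group G] {d : ℕ}

theorem mul_mem_cubes (T : GEA k S G) {l l' : ℕ} {v v' v'' : Obj d S} {x y : Vertex d → G}
    (hx : x ∈ T.cubes l v v') (hy : y ∈ T.cubes l' v' v'') : x * y ∈ T.cubes (l + l') v v'' := by
  obtain ⟨e, ⟨he, hev⟩, rfl⟩ := hx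
  obtain ⟨f, ⟨hf, hfv⟩, rfl⟩ := hy
  have hdiv : ∀ ω, (dot ω (fun i => e i * k ^ l' + f i) + v''.r ω) / k ^ l' =
      dot ω e + v'.r ω := fun ω => by
    rw [dot_add, dot_mul_const, add_assoc, mul_comm,
      Nat.mul_add_div (pow_pos (Nat.pos_of_neZero k) _), (hfv ω).2]
  have hexp : ∀ ω, expand k (l + l') (dot ω (fun i => e i * k ^ l' + f i) + v''.r ω) =
      expand k l (dot ω e + v'.r ω) ++ expand k l' (dot ω f + v''.r ω) := fun ω => by
    rw [expand_add, hdiv, dot_add, dot_mul_const, add_assoc, expand_mul_pow_add]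
  refine ⟨fun i => e i * k ^ l' + f i, ⟨fun i => mul_pow_add_lt (he i) (hf i), fun ω => ⟨?_, ?_⟩⟩, ?_⟩
  · rw [hexp, stepWord_append, ← (hev ω).1]
    exact (hfv ω).1
  · rw [add_comm l, pow_add, ← Nat.div_div_eq_div_mul, hdiv]
    exact (hev ω).2
  · funext ω
    rw [morLabel, hexp, labWord_append, ← (hev ω).1]
    rfl

theorem limitCubes_eq_of_forall_ge {T : GEA k S G} {l₀ : ℕ} {v v' : Obj d S} {A : Set (Vertex d → G)}
    (h : ∀ l ≥ l₀, T.cubes l v v' = A) : T.limitCubes v v' = A := by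
  ext x
  constructor
  · intro hx
    obtain ⟨l, hl, hl'⟩ := (Filter.Eventually.and hx (Filter.eventually_ge_atTop l₀)).exists
    exact h l hl' ▸ hl
  · intro hx
    filter_upwards [Filter.eventually_ge_atTop l₀] with l hl
    rwa [h l hl]

omit [Group G] in
theorem inU_base (T : GEA k S G) (d : ℕ) : T.InU (T.base d) := by
  have h : (0 : Fin (d + 1) → ℕ) ∈ T.Mor 0 (T.base d) (T.base d) :=
    ⟨fun _ => by simp, fun ω => ⟨rfl, by simp [base, dot]⟩⟩
  exact ⟨⟨0, 0, h⟩, ⟨0, 0, h⟩⟩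

/-- The carries are at most `d + 1`. -/
instance finite_obj [Finite S] : Finite (Obj d S) := by
  have hr : ∀ (v : Obj d S) (ω : Vertex d), v.r ω < d + 2 := fun v ω => by
    obtain ⟨t, ht, hv⟩ := v.r_mem
    rw [hv, Nat.floor_lt']
    · have h1 : dot ω t ≤ 1 + ∑ _j : Fin d, (1 : ℝ) := by
        refine add_le_add (ht 0).2.le (Finset.sum_le_sum fun j _ => ?_)
        rcases (show (ω j : ℕ) = 0 ∨ (ω j : ℕ) = 1 by omega) with h | h <;> rw [h]
        · simp
        · simpa using (ht j.succ).2.le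
      simp only [Finset.sum_const, Finset.card_univ, Fintype.card_fin, nsmul_eq_mul, mul_one] at h1
      push_cast
      linarith
    · omega
  refine Finite.of_injective
    (fun v : Obj d S => (v.s, fun ω => (⟨v.r ω, hr v ω⟩ : Fin (d + 2)))) fun v w h => ?_
  obtain ⟨s, r, _⟩ := v
  obtain ⟨s', r', _⟩ := w
  simp only [Prod.mk.injEq] at h
  obtain ⟨rfl, h⟩ := h
  have : r = r' := funext fun ω => congrArg Fin.val (congrFun h ω)
  subst this
  rfl

end Composition

/-! ### Cubes and their residues -/

section ResidueCubes

variable {k : ℕ} [NeZero k] {S G : Type*} [Group G] {d : ℕ} {d' : ℕ}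

/-- The cubes whose residues modulo `d'` are those of a morphism `v ⟶ v'`: a linear form on the
cube, corrected by the carries of `v` and `v'`. -/
def residueCubes (π : G →* Multiplicative (ZMod d')) (v v' : Obj d S) : Set (Vertex d → G) :=
  {x | ∃ e : Fin (d + 1) → ZMod d', ∀ ω,
    Multiplicative.toAdd (π (x ω)) = dot ω e + v'.r ω - v.r ω}

theorem cubes_subset_residueCubes {T : GEA k S G} {π : G →* Multiplicative (ZMod d')}
    (hπ : ∀ (s : S) (w : List (Fin k)),
      π (T.labWord s w) = Multiplicative.ofAdd ((val w : ℕ) : ZMod d'))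
    (hk1 : (k : ZMod d') = 1) (l : ℕ) (v v' : Obj d S) :
    T.cubes l v v' ⊆ residueCubes π v v' := by
  rintro _ ⟨e, ⟨-, he⟩, rfl⟩
  refine ⟨fun i => e i, fun ω => ?_⟩
  have h := congrArg (Nat.cast (R := ZMod d')) (Nat.div_add_mod (dot ω e + v'.r ω) (k ^ l))
  rw [← (he ω).2] at h
  push_cast [hk1] at h
  rw [one_pow, one_mul] at h
  rw [morLabel, hπ, val_expand, toAdd_ofAdd, dot_natCast, ← h]
  abel

theorem exists_natCast_eq [NeZero d'] (e : Fin (d + 1) → ZMod d') :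
    ∃ f : Fin (d + 1) → ℕ, ∀ ω : Vertex d, dot ω e = ((dot ω f : ℕ) : ZMod d') :=
  ⟨fun i => (e i).val, fun ω => by simp [← dot_natCast]⟩

omit [NeZero k] in
/-- Transport of a residue cube to the base object by cubes joining the ends to it. -/
theorem residueCubes_conj {T : GEA k S G} {π : G →* Multiplicative (ZMod d')} {v v' : Obj d S}
    {x y z : Vertex d → G} (hx : x ∈ residueCubes π v v')
    (hy : y ∈ residueCubes π v (T.base d)) (hz : z ∈ residueCubes π (T.base d) v') :
    y⁻¹ * x * z⁻¹ ∈ residueCubes π (T.base d) (T.base d) := by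
  obtain ⟨e, he⟩ := hx
  obtain ⟨f, hf⟩ := hy
  obtain ⟨g, hg⟩ := hz
  refine ⟨fun i => e i - (f i + g i), fun ω => ?_⟩
  simp only [Pi.mul_apply, Pi.inv_apply, map_mul, map_inv, toAdd_mul, toAdd_inv, he, hf, hg,
    dot_sub, dot_add, base, Nat.cast_zero]
  abel

/-- With `g_v = (g₀ ^ r_ω)_ω`, the residue cubes `v ⟶ v'` form the set
`g_v⁻¹ G₀^[d] H g_{v'}`. -/
theorem residueCubes_eq [Finite G] [NeZero d'] {G₀ : Subgroup G} {g₀ : G}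
    {π : G →* Multiplicative (ZMod d')} (hker : π.ker = G₀)
    (hg₀ : π g₀ = Multiplicative.ofAdd 1) (v v' : Obj d S) :
    residueCubes π v v' = {(fun ω => g₀ ^ v.r ω : Vertex d → G)⁻¹} *
      (Subgroup.pi Set.univ (fun _ : Vertex d => G₀) : Set (Vertex d → G)) *
      (cubePowers d g₀ : Set (Vertex d → G)) * {fun ω => g₀ ^ v'.r ω} := by
  have hpow : ∀ n : ℕ, Multiplicative.toAdd (π (g₀ ^ n)) = n := fun n => by
    rw [map_pow, hg₀, toAdd_pow, toAdd_ofAdd, nsmul_one]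
  have hmem : ∀ x, x ∈ G₀ ↔ Multiplicative.toAdd (π x) = 0 := fun x => by
    rw [← hker, MonoidHom.mem_ker]
    rfl
  ext x
  constructor
  · rintro ⟨e, he⟩
    obtain ⟨f, hf⟩ := exists_natCast_eq e
    refine ⟨_, ⟨_, ⟨_, rfl, (fun ω => g₀ ^ v.r ω) * x * (fun ω => g₀ ^ v'.r ω)⁻¹ *
      (fun ω => g₀ ^ dot ω f)⁻¹, fun ω _ => ?_, rfl⟩, _, ⟨f, rfl⟩, rfl⟩, _, rfl, ?_⟩
    · show _ ∈ G₀
      rw [hmem]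
      simp only [Pi.mul_apply, Pi.inv_apply, map_mul, map_inv, toAdd_mul, toAdd_inv, hpow, he, hf]
      abel
    · simp only
      group
  · rintro ⟨_, ⟨_, ⟨_, rfl, p, hp, rfl⟩, _, ⟨f, rfl⟩, rfl⟩, _, rfl, rfl⟩
    refine ⟨fun i => f i, fun ω => ?_⟩
    have := (hmem _).1 (hp ω trivial)
    simp only [Pi.mul_apply, Pi.inv_apply, map_mul, map_inv, toAdd_mul, toAdd_inv, hpow, this,
      dot_natCast]
    abel

end ResidueCubes

section Limit

variable {k : ℕ} [NeZero k] {S G : Type*} [Group G] [Finite G] {T : GEA k S G} {d' : ℕ}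
  {G₀ : Subgroup G} {g₀ : G}

namespace IsEfficientWith

/-- A reset word appended to an element of the cube group returns all vertices to the initial
state. -/
theorem eventually_mem_cubes_base (hT : T.IsEfficientWith d' G₀ g₀) (hk : 2 ≤ k) {d : ℕ}
    {x : Vertex d → G} (hx : x ∈ hT.cubeGroup hk d) :
    ∃ l₀, ∀ l ≥ l₀, x ∈ T.cubes l (T.base d) (T.base d) := by
  obtain ⟨e, he⟩ := hx
  obtain ⟨z, hz, -⟩ := hT.exists_isResetWord hk
  refine ⟨dot (fun _ => 1) e + z.length, fun l hl => ?_⟩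
  obtain ⟨p, rfl⟩ := Nat.exists_eq_add_of_le' ((Nat.le_add_left _ _).trans hl)
  have hp : ∀ ω, dot ω e < k ^ p := fun ω => (dot_le_dot_one ω e).trans_lt
    ((Nat.lt_pow_self hk).trans_le (Nat.pow_le_pow_right (by omega) (by omega)))
  have hdot : ∀ ω, dot ω (fun i => e i * k ^ z.length + (Pi.single 0 (val z) : _ → ℕ) i) =
      dot ω e * k ^ z.length + val z := fun ω => by
    rw [dot_add, dot_mul_const, dot_single_zero]
  have hlt : ∀ ω, dot ω e * k ^ z.length + val z < k ^ (p + z.length) := fun ω =>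
    mul_pow_add_lt (hp ω) (val_lt z)
  have hexp : ∀ ω, expand k (p + z.length) (dot ω e * k ^ z.length + val z) =
      expand k p (dot ω e) ++ z := fun ω => by rw [expand_concat _ _ (val_lt z), expand_val]
  refine ⟨fun i => e i * k ^ z.length + (Pi.single 0 (val z) : _ → ℕ) i,
    ⟨fun i => ?_, fun ω => ⟨?_, ?_⟩⟩, ?_⟩
  · have h := le_dot_one (fun i => e i * k ^ z.length + (Pi.single 0 (val z) : _ → ℕ) i) i
    rw [hdot] at h
    exact h.trans_lt (hlt _)
  · simp only [base, add_zero, hdot, hexp, stepWord_append, (hz _).1]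
  · simp only [base, add_zero, hdot, Nat.div_eq_of_lt (hlt ω)]
  · funext ω
    simp only [morLabel, base, add_zero, hdot, hexp, labWord_append, (hz _).2, mul_one, he,
      hT.labWord_expand hk (hp ω)]

theorem residueCubes_base_subset (hT : T.IsEfficientWith d' G₀ g₀) (hk : 2 ≤ k)
    {π : G →* Multiplicative (ZMod d')} (hker : π.ker = G₀)
    (hπ : ∀ (s : S) (w : List (Fin k)),
      π (T.labWord s w) = Multiplicative.ofAdd ((val w : ℕ) : ZMod d')) (d : ℕ) :
    residueCubes π (T.base d) (T.base d) ⊆ hT.cubeGroup hk d := by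
  rintro x ⟨e, he⟩
  have : NeZero d' := ⟨(hT.pos hk).ne'⟩
  obtain ⟨f, hf⟩ := exists_natCast_eq e
  let y : Vertex d → G := fun ω => T.seq (dot ω f)
  have hy : y ∈ hT.cubeGroup hk d := ⟨f, fun _ => rfl⟩
  have hxy : x * y⁻¹ ∈ hT.cubeGroup hk d := hT.pi_le_cubeGroup hk d fun ω _ => by
    have hyω : π (y ω) = Multiplicative.ofAdd ((dot ω f : ℕ) : ZMod d') := by
      have h := hπ T.init (expand k (dot ω f) (dot ω f))
      rwa [val_expand, Nat.mod_eq_of_lt (Nat.lt_pow_self hk)] at h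
    have hxω : π (x ω) = Multiplicative.ofAdd ((dot ω f : ℕ) : ZMod d') := by
      have h := he ω
      rw [add_sub_cancel_right, hf] at h
      exact h
    show _ ∈ G₀
    rw [← hker, MonoidHom.mem_ker, Pi.mul_apply, Pi.inv_apply, map_mul, map_inv, hxω, hyω,
      mul_inv_cancel]
  simpa using mul_mem hxy hy

/-- Every residue cube `v ⟶ v'` factors through the base object, with fixed cubes `v ⟶ v₀` and
`v₀ ⟶ v'`, so its occurrence for large degrees reduces to that of the cube group. -/
theorem exists_cubes_eq [Finite S] (hT : T.IsEfficientWith d' G₀ g₀) (hk : 2 ≤ k)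
    {π : G →* Multiplicative (ZMod d')} (hker : π.ker = G₀)
    (hπ : ∀ (s : S) (w : List (Fin k)),
      π (T.labWord s w) = Multiplicative.ofAdd ((val w : ℕ) : ZMod d')) (d : ℕ) :
    ∃ l₀, ∀ l ≥ l₀, ∀ v v' : Obj d S, T.InU v → T.InU v' →
      T.cubes l v v' = residueCubes π v v' := by
  have hk1 := hT.natCast_eq_one hk
  have hto : ∀ v : Obj d S, ∃ a, T.InU v → ∃ y, y ∈ T.cubes a v (T.base d) := fun v => by
    by_cases h : T.InU v
    · obtain ⟨a, e, he⟩ := h.1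
      exact ⟨a, fun _ => ⟨_, e, he, rfl⟩⟩
    · exact ⟨0, fun h' => absurd h' h⟩
  have hfrom : ∀ v : Obj d S, ∃ b, T.InU v → ∃ y, y ∈ T.cubes b (T.base d) v := fun v => by
    by_cases h : T.InU v
    · obtain ⟨a, e, he⟩ := h.2
      exact ⟨a, fun _ => ⟨_, e, he, rfl⟩⟩
    · exact ⟨0, fun h' => absurd h' h⟩
  have hbase : ∀ x : Vertex d → G, ∃ c, x ∈ hT.cubeGroup hk d →
      ∀ l ≥ c, x ∈ T.cubes l (T.base d) (T.base d) := fun x => by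
    by_cases h : x ∈ hT.cubeGroup hk d
    · obtain ⟨c, hc⟩ := hT.eventually_mem_cubes_base hk h
      exact ⟨c, fun _ => hc⟩
    · exact ⟨0, fun h' => absurd h' h⟩
  choose a ha using hto
  choose b hb using hfrom
  choose c hc using hbase
  obtain ⟨A, hA⟩ := Finite.exists_le a
  obtain ⟨B, hB⟩ := Finite.exists_le b
  obtain ⟨C, hC⟩ := Finite.exists_le c
  refine ⟨A + C + B, fun l hl v v' hv hv' =>
    (cubes_subset_residueCubes hπ hk1 l v v').antisymm fun x hx => ?_⟩
  obtain ⟨y, hy⟩ := ha v hv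
  obtain ⟨z, hz⟩ := hb v' hv'
  have h1 := hT.residueCubes_base_subset hk hker hπ d
    (residueCubes_conj (T := T) hx (cubes_subset_residueCubes hπ hk1 _ _ _ hy)
      (cubes_subset_residueCubes hπ hk1 _ _ _ hz))
  have hAv := hA v
  have hBv := hB v'
  have h2 := hc _ h1 (l - a v - b v') ((hC _).trans (by omega))
  have h3 := mul_mem_cubes T (mul_mem_cubes T hy h2) hz
  rw [show a v + (l - a v - b v') + b v' = l by omega] at h3
  convert h3 using 1
  group

end IsEfficientWith

end Limit

/-! ### The cyclic factor -/

section Cyclic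

variable {k : ℕ} [NeZero k] {m : ℕ}

omit [NeZero k] in
theorem cyclic_labWord (hk1 : (k : ZMod m) = 1) (s : Unit) (w : List (Fin k)) :
    (cyclic k m).labWord s w = Multiplicative.ofAdd ((val w : ℕ) : ZMod m) := by
  induction w using List.reverseRecOn with
  | nil => simp [labWord, val]
  | append_singleton w j ih =>
    rw [labWord_append, ih, val_append_singleton]
    simp [labWord, cyclic, hk1]

theorem limitCubes_cyclic (hk : 2 ≤ k) [NeZero m] (hk1 : (k : ZMod m) = 1) (d : ℕ) :
    (cyclic k m).limitCubes ((cyclic k m).base d) ((cyclic k m).base d) =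
      residueCubes (MonoidHom.id _) ((cyclic k m).base d) ((cyclic k m).base d) := by
  have hlab : ∀ (s : Unit) (w : List (Fin k)), MonoidHom.id _ ((cyclic k m).labWord s w) =
      Multiplicative.ofAdd ((val w : ℕ) : ZMod m) := cyclic_labWord hk1
  ext x
  constructor
  · intro hx
    obtain ⟨l, hl⟩ := Filter.Eventually.exists hx
    exact cubes_subset_residueCubes hlab hk1 l _ _ hl
  · rintro ⟨e, he⟩
    obtain ⟨f, hf⟩ := exists_natCast_eq e
    filter_upwards [Filter.eventually_ge_atTop (dot (fun _ => 1) f)] with l hl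
    have hlt : dot (fun _ => 1) f < k ^ l := hl.trans_lt (Nat.lt_pow_self hk)
    have hlt' : ∀ ω, dot ω f < k ^ l := fun ω => (dot_le_dot_one ω f).trans_lt hlt
    refine ⟨f, ⟨fun i => (le_dot_one f i).trans_lt hlt, fun ω => ⟨rfl, ?_⟩⟩, ?_⟩
    · simp only [base, add_zero, Nat.div_eq_of_lt (hlt' ω)]
    · funext ω
      have h := he ω
      simp only [base, Nat.cast_zero, add_zero, sub_zero, hf] at h
      rw [morLabel, cyclic_labWord hk1, val_expand]
      simp only [base, add_zero, Nat.mod_eq_of_lt (hlt' ω)]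
      rw [← h]
      rfl

/-- The factor map onto `Z(m)` given by a homomorphism which sends labels of words to values. -/
def factorMapCyclic [NeZero m] {S G : Type*} [Group G] (T : GEA k S G)
    (π : G →* Multiplicative (ZMod m)) {g₀ : G} (hg₀ : π g₀ = Multiplicative.ofAdd 1)
    (hπ : ∀ (s : S) (w : List (Fin k)),
      π (T.labWord s w) = Multiplicative.ofAdd ((val w : ℕ) : ZMod m)) :
    FactorMap T (cyclic k m) where
  φ := fun _ => ()
  π := π
  map_init := rfl
  map_step := fun _ _ => rfl
  map_lab := fun s j => by
    have := hπ s [j]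
    simpa [labWord, val, cyclic] using this.symm
  φ_surjective := fun _ => ⟨T.init, rfl⟩
  π_surjective := fun y => ⟨g₀ ^ (Multiplicative.toAdd y).val, by
    rw [map_pow, hg₀, ← ofAdd_nsmul, nsmul_one, ZMod.natCast_zmod_val, ofAdd_toAdd]⟩

end Cyclic

end GEA

theorem mainTheorem7 {k : ℕ} [NeZero k] (hk : 2 ≤ k)
    {S : Type*} [Finite S] {G : Type*} [Group G] [Finite G]
    (T : GEA k S G) (d' : ℕ) (G₀ : Subgroup G) (g₀ : G)
    (hT : T.IsEfficientWith d' G₀ g₀) :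
    (∀ d : ℕ, ∃ (g : GEA.Obj d S → (GEA.Vertex d → G)) (l₀ : ℕ),
      ∀ v v' : GEA.Obj d S, T.InU v → T.InU v' →
        (∀ l ≥ l₀, T.cubes l v v' = T.limitCubes v v') ∧
        T.limitCubes v v' =
          {(g v)⁻¹} * (Subgroup.pi Set.univ (fun _ : GEA.Vertex d => G₀) : Set (GEA.Vertex d → G)) *
            (GEA.cubePowers d g₀ : Set (GEA.Vertex d → G)) * {g v'}) ∧
    ∃ F : GEA.FactorMap T (GEA.cyclic k d'), F.IsCharacteristic := by
  have : NeZero d' := ⟨(hT.pos hk).ne'⟩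
  obtain ⟨π, hker, hg₀, hπ⟩ := hT.exists_residueHom hk
  have hlim := fun d => hT.exists_cubes_eq hk hker hπ d
  refine ⟨fun d => ?_, T.factorMapCyclic π hg₀ hπ, fun d => ?_⟩
  · obtain ⟨l₀, hl₀⟩ := hlim d
    refine ⟨fun v ω => g₀ ^ v.r ω, l₀, fun v v' hv hv' => ?_⟩
    have h := GEA.limitCubes_eq_of_forall_ge fun l hl => hl₀ l hl v v' hv hv'
    exact ⟨fun l hl => (hl₀ l hl v v' hv hv').trans h.symm,
      h.trans (GEA.residueCubes_eq hker hg₀ v v')⟩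
  · obtain ⟨l₀, hl₀⟩ := hlim d
    rw [GEA.limitCubes_eq_of_forall_ge fun l hl =>
      hl₀ l hl _ _ (T.inU_base d) (T.inU_base d), GEA.limitCubes_cyclic hk (hT.natCast_eq_one hk)]
    rfl
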